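/- Let $G$ be a group. All actions are right actions, $x^g=g^{-1}xg$ and $[x,y]=x^{-1}y^{-1}xy$. For groups $A$, $B$ acting compatibly on each other by automorphisms (and on themselves by conjugation), the non-abelian tensor product $A\otimes B$ is the group generated by the symbols $a\otimes b$ ($a\in A$, $b\in B$) subject to the relations $$aa_1\otimes b=(a^{a_1}\otimes b^{a_1})(a_1\otimes b),\qquad a\otimes bb_1=(a\otimes b_1)(a^{b_1}\otimes b^{b_1})$$ for all $a,a_1\in A$ and $b,b_1\in B$. Put $G^{\otimes 1}=G$, with $G$ acting by conjugation, and $\lambda_1^G=\mathrm{id}_G$. For $n\ge 1$ put $G^{\otimes (n+1)}=G^{\otimes n}\otimes G$, where $G^{\otimes n}$ acts on $G$ by $g^{t}=g^{\lambda_n^G(t)}$; let $G$ act on $G^{\otimes(n+1)}$ by $(t\otimes g)^h=t^h\otimes g^h$, and let $\lambda_{n+1}^G(t\otimes g)=[\lambda_n^G(t),g]$. This gives a homomorphism $\lambda_n^G\colon G^{\otimes n}\to\gamma_n(G)$ to the $n$-th term of the lower central series ($\gamma_1(G)=G$, $\gamma_{n+1}(G)=[\gamma_n(G),G]$), which sends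 $((g_1\otimes g_2)\otimes\cdots)\otimes g_n$ to the left-normed commutator $[g_1,g_2,\ldots,g_n]$. If $G$ is finitely presented, then for every $n\ge 2$ the kernel of $\lambda_n^G\colon G^{\otimes n}\to\gamma_n(G)$ is a finitely generated abelian group. -/

import Mathlib

open MulOpposite

namespace NonabelianTensor

universe u v

/-- A right action of `H` on the group `G` by automorphisms: `g ^ h` is `a (op h) g`, so that
`(g ^ h) ^ h' = g ^ (h * h')`. -/
abbrev RightAction (H : Type v) (G : Type u) [Group H] [Group G] := Hᵐᵒᵖ →* MulAut G

/-- The right action of a group on itself by conjugation, `x ^ g = g⁻¹ * x * g`. -/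
def conjAction (G : Type u) [Group G] : RightAction G G where
  toFun g := MulAut.conj (unop g)⁻¹
  map_one' := by simp
  map_mul' a b := by simp

@[simp] theorem conjAction_apply {G : Type u} [Group G] (g x : G) :
    conjAction G (op g) x = g⁻¹ * x * g := by
  simp [conjAction]

section Tensor

variable {G : Type u} {H : Type v} [Group G] [Group H]

/-- Compatibility of an action `a` of `H` on `G` with an action `b` of `G` on `H`:
`g ^ (h ^ g₁) = ((g ^ g₁⁻¹) ^ h) ^ g₁` and `h ^ (g ^ h₁) = ((h ^ h₁⁻¹) ^ g) ^ h₁`,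
each group acting on itself by conjugation. -/
def Compatible (a : RightAction H G) (b : RightAction G H) : Prop :=
  (∀ (g g₁ : G) (h : H), a (op (b (op g₁) h)) g =
    conjAction G (op g₁) (a (op h) (conjAction G (op g₁⁻¹) g))) ∧
  (∀ (h h₁ : H) (g : G), b (op (a (op h₁) g)) h =
    conjAction H (op h₁) (b (op g) (conjAction H (op h₁⁻¹) h)))

/-- The defining relators of the non-abelian tensor product, expressing
`g g₁ ⊗ h = (g ^ g₁ ⊗ h ^ g₁) (g₁ ⊗ h)` and `g ⊗ h h₁ = (g ⊗ h₁) (g ^ h₁ ⊗ h ^ h₁)`. -/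
inductive IsRelator (a : RightAction H G) (b : RightAction G H) : FreeGroup (G × H) → Prop
  | mul_left (g g₁ : G) (h : H) : IsRelator a b
      (FreeGroup.of (g * g₁, h) *
        (FreeGroup.of (conjAction G (op g₁) g, b (op g₁) h) * FreeGroup.of (g₁, h))⁻¹)
  | mul_right (g : G) (h h₁ : H) : IsRelator a b
      (FreeGroup.of (g, h * h₁) *
        (FreeGroup.of (g, h₁) * FreeGroup.of (a (op h₁) g, conjAction H (op h₁) h))⁻¹)

/-- The non-abelian tensor product `G ⊗ H` of two groups acting on each other (via `a` and `b`;
in every use below the two actions are compatible). -/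
abbrev Tensor (a : RightAction H G) (b : RightAction G H) : Type (max u v) :=
  PresentedGroup {r | IsRelator a b r}

variable {a : RightAction H G} {b : RightAction G H}

/-- The generator `g ⊗ h`. -/
def tmul (a : RightAction H G) (b : RightAction G H) (g : G) (h : H) : Tensor a b :=
  PresentedGroup.of (g, h)

theorem tmul_mul_left (g g₁ : G) (h : H) :
    tmul a b (g * g₁) h = tmul a b (g₁⁻¹ * g * g₁) (b (op g₁) h) * tmul a b g₁ h := by
  have := PresentedGroup.mk_eq_mk_of_mul_inv_mem (rels := {r | IsRelator a b r})
    (IsRelator.mul_left (a := a) (b := b) g g₁ h)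
  simpa [tmul, PresentedGroup.of] using this

theorem tmul_mul_right (g : G) (h h₁ : H) :
    tmul a b g (h * h₁) = tmul a b g h₁ * tmul a b (a (op h₁) g) (h₁⁻¹ * h * h₁) := by
  have := PresentedGroup.mk_eq_mk_of_mul_inv_mem (rels := {r | IsRelator a b r})
    (IsRelator.mul_right (a := a) (b := b) g h h₁)
  simpa [tmul, PresentedGroup.of] using this

/-- The universal property: a function of two variables respecting the defining relations
extends to the tensor product. -/
def Tensor.lift {K : Type*} [Group K] (f : G → H → K)
    (h₁ : ∀ g g₁ h, f (g * g₁) h = f (g₁⁻¹ * g * g₁) (b (op g₁) h) * f g₁ h)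
    (h₂ : ∀ g h h₁, f g (h * h₁) = f g h₁ * f (a (op h₁) g) (h₁⁻¹ * h * h₁)) :
    Tensor a b →* K :=
  PresentedGroup.toGroup (f := fun p : G × H => f p.1 p.2) (by
    rintro r (⟨g, g₁, h⟩ | ⟨g, h, h'⟩)
    · simp [h₁ g g₁ h]
    · simp [h₂ g h h'])

@[simp] theorem Tensor.lift_tmul {K : Type*} [Group K] (f : G → H → K) (h₁ h₂) (g : G) (h : H) :
    Tensor.lift (a := a) (b := b) f h₁ h₂ (tmul a b g h) = f g h :=
  PresentedGroup.toGroup.of _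

theorem Tensor.hom_ext {K : Type*} [Group K] {φ ψ : Tensor a b →* K}
    (h : ∀ x y, φ (tmul a b x y) = ψ (tmul a b x y)) : φ = ψ :=
  PresentedGroup.ext fun p => h p.1 p.2

end Tensor

/-- A crossed module over `G`, in right-action form: a group `T` with a right action of `G` and an
equivariant homomorphism `∂ : T → G` satisfying `t ^ ∂ s = s⁻¹ t s`. -/
structure CrossedModule (G : Type u) [Group G] where
  T : Type u
  [group : Group T]
  act : RightAction G T
  bdry : T →* G
  bdry_act : ∀ (g : G) (t : T), bdry (act (op g) t) = g⁻¹ * bdry t * g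
  peiffer : ∀ s t : T, act (op (bdry s)) t = s⁻¹ * t * s

attribute [instance] CrossedModule.group

namespace CrossedModule

variable {G : Type u} [Group G]

/-- The identity of `G`, with the conjugation action. -/
def refl (G : Type u) [Group G] : CrossedModule G where
  T := G
  act := conjAction G
  bdry := MonoidHom.id G
  bdry_act := by simp
  peiffer := by simp

variable (M : CrossedModule G)

/-- The right action of `T` on `G` through `∂`: `g ^ t = (∂ t)⁻¹ g (∂ t)`. -/
def coact : RightAction M.T G := (conjAction G).comp (MonoidHom.op M.bdry)

@[simp] theorem coact_apply (t : M.T) (g : G) :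
    M.coact (op t) g = (M.bdry t)⁻¹ * g * M.bdry t := by
  simp [coact]

/-- The actions of `G` on `T` and of `T` on `G` are compatible. -/
theorem compatible : Compatible M.act M.coact := by
  constructor
  · intro t t₁ g
    simp only [coact_apply, conjAction_apply]
    rw [← M.peiffer t₁, show (t₁⁻¹)⁻¹ * t * t₁⁻¹ = M.act (op (M.bdry t₁)⁻¹) t by
      rw [← map_inv, M.peiffer]]
    simp only [op_mul, map_mul, MulAut.mul_apply]
  · intro h h₁ t
    simp only [coact_apply, conjAction_apply, M.bdry_act]
    group

/-- The non-abelian tensor product `T ⊗ G`. -/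
abbrev tensorType : Type u := Tensor M.act M.coact

theorem act_act (g h : G) (t : M.T) : M.act (op g) (M.act (op h) t) = M.act (op (h * g)) t := by
  rw [op_mul, map_mul, MulAut.mul_apply]

/-- The diagonal endomorphism `t ⊗ x ↦ t ^ g ⊗ x ^ g` of `T ⊗ G`. -/
def diag (g : G) : M.tensorType →* M.tensorType :=
  Tensor.lift (fun t x => tmul M.act M.coact (M.act (op g) t) (g⁻¹ * x * g))
    (fun t t₁ x => by
      simp only [map_mul, map_inv]
      rw [tmul_mul_left]
      simp [M.bdry_act, mul_assoc])
    (fun t x y => by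
      rw [show g⁻¹ * (x * y) * g = (g⁻¹ * x * g) * (g⁻¹ * y * g) by group, tmul_mul_right]
      simp only [M.act_act]
      congr 2 <;> group)

@[simp] theorem diag_tmul (g : G) (t : M.T) (x : G) :
    M.diag g (tmul M.act M.coact t x) =
      tmul M.act M.coact (M.act (op g) t) (g⁻¹ * x * g) :=
  Tensor.lift_tmul ..

theorem diag_comp (g h : G) : (M.diag g).comp (M.diag h) = M.diag (h * g) :=
  Tensor.hom_ext fun t x => by
    simp only [MonoidHom.comp_apply, diag_tmul, M.act_act]
    congr 1
    group

theorem diag_one : M.diag 1 = MonoidHom.id _ :=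
  Tensor.hom_ext fun t x => by simp

/-- The diagonal right action of `G` on `T ⊗ G`, `(t ⊗ x) ^ g = t ^ g ⊗ x ^ g`. -/
def diagAction : RightAction G M.tensorType where
  toFun g := MonoidHom.toMulEquiv (M.diag (unop g)) (M.diag (unop g)⁻¹)
    (by rw [diag_comp, mul_inv_cancel, diag_one]) (by rw [diag_comp, inv_mul_cancel, diag_one])
  map_one' := by
    ext x
    exact DFunLike.congr_fun M.diag_one x
  map_mul' g h := by
    ext x
    exact (DFunLike.congr_fun (M.diag_comp (unop g) (unop h)) x).symm

theorem diagAction_apply (g : G) (x : M.tensorType) : M.diagAction (op g) x = M.diag g x := rfl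

/-- The homomorphism `T ⊗ G → G`, `t ⊗ g ↦ [∂ t, g] = (∂ t)⁻¹ g⁻¹ (∂ t) g`. -/
def tensorBdry : M.tensorType →* G :=
  Tensor.lift (fun t g => (M.bdry t)⁻¹ * g⁻¹ * M.bdry t * g)
    (fun t t₁ g => by simp; group)
    (fun t g g₁ => by simp [M.bdry_act]; group)

@[simp] theorem tensorBdry_tmul (t : M.T) (g : G) :
    M.tensorBdry (tmul M.act M.coact t g) = (M.bdry t)⁻¹ * g⁻¹ * M.bdry t * g :=
  Tensor.lift_tmul ..

theorem tensorBdry_diag (g : G) (x : M.tensorType) :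
    M.tensorBdry (M.diag g x) = g⁻¹ * M.tensorBdry x * g := by
  have : M.tensorBdry.comp (M.diag g) = (MulAut.conj g⁻¹).toMonoidHom.comp M.tensorBdry :=
    Tensor.hom_ext fun t y => by simp [M.bdry_act]; group
  simpa using DFunLike.congr_fun this x

theorem tmul_conj_aux (s t : M.T) (g h : G) :
    tmul M.act M.coact (M.act (op (h * M.bdry s)) t) ((h * M.bdry s)⁻¹ * g * (h * M.bdry s)) *
        tmul M.act M.coact s h =
      tmul M.act M.coact s h *
        tmul M.act M.coact (M.act (op (M.bdry s * h)) t)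
          ((M.bdry s * h)⁻¹ * g * (M.bdry s * h)) := by
  have e₁ := tmul_mul_left (a := M.act) (b := M.coact) t s (g * h)
  have e₂ := tmul_mul_right (a := M.act) (b := M.coact) (t * s) g h
  rw [tmul_mul_right s g h, ← M.peiffer s t, coact_apply,
    show (M.bdry s)⁻¹ * (g * h) * M.bdry s =
      ((M.bdry s)⁻¹ * g * M.bdry s) * ((M.bdry s)⁻¹ * h * M.bdry s) by group,
    tmul_mul_right (M.act (op (M.bdry s)) t), M.act_act] at e₁
  rw [tmul_mul_left t s h, map_mul, tmul_mul_left (M.act (op h) t), ← M.peiffer s t,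
    ← M.peiffer (M.act (op h) s), M.act_act, M.bdry_act, coact_apply, coact_apply,
    M.bdry_act] at e₂
  have e := e₁.symm.trans e₂
  simp only [mul_assoc] at e
  have e := mul_left_cancel e
  simp only [← mul_assoc] at e
  have e := mul_right_cancel e
  convert e using 3 <;> group

theorem tensor_peiffer (s x : M.tensorType) :
    M.diag (M.tensorBdry s) x = s⁻¹ * x * s := by
  let S : Subgroup M.tensorType :=
    { carrier := {s | ∀ x, M.diag (M.tensorBdry s) x = s⁻¹ * x * s}
      one_mem' := fun x => by simp [diag_one]
      mul_mem' := fun {s s'} hs hs' x => by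
        rw [map_mul, ← diag_comp, MonoidHom.comp_apply, hs, hs']
        group
      inv_mem' := fun {s} hs x => by
        have h : M.diag (M.tensorBdry s) (M.diag (M.tensorBdry s)⁻¹ x) = x := by
          rw [← MonoidHom.comp_apply, diag_comp, inv_mul_cancel, diag_one, MonoidHom.id_apply]
        rw [hs] at h
        rw [map_inv]
        nth_rw 2 [← h]
        group }
  refine PresentedGroup.generated_by _ S (fun p => ?_) s x
  change ∀ x, M.diag (M.tensorBdry (tmul M.act M.coact p.1 p.2)) x =
    (tmul M.act M.coact p.1 p.2)⁻¹ * x * tmul M.act M.coact p.1 p.2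
  intro x
  have key : M.diag (M.tensorBdry (tmul M.act M.coact p.1 p.2)) =
      (MulAut.conj (tmul M.act M.coact p.1 p.2)⁻¹).toMonoidHom := by
    refine Tensor.hom_ext fun t g => ?_
    have e := M.tmul_conj_aux p.1 (M.act (op (p.2 * M.bdry p.1)⁻¹) t)
      ((p.2 * M.bdry p.1) * g * (p.2 * M.bdry p.1)⁻¹) p.2
    simp only [M.act_act] at e
    rw [inv_mul_cancel, op_one, map_one, MulAut.one_apply] at e
    simp only [tensorBdry_tmul, diag_tmul, MulEquiv.toMonoidHom_eq_coe, MonoidHom.coe_coe,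
      MulAut.conj_apply, inv_inv]
    refine Eq.symm ?_
    rw [mul_assoc _⁻¹, inv_mul_eq_iff_eq_mul]
    convert e using 3 <;> group
  simpa using DFunLike.congr_fun key x

/-- The crossed module `T ⊗ G → G`. -/
def tensor : CrossedModule G where
  T := M.tensorType
  act := M.diagAction
  bdry := M.tensorBdry
  bdry_act := M.tensorBdry_diag
  peiffer := M.tensor_peiffer

theorem tensorBdry_mem (N : Subgroup G) (hN : ∀ t, M.bdry t ∈ N) (x : M.tensorType) :
    M.tensorBdry x ∈ ⁅N, (⊤ : Subgroup G)⁆ := by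
  refine PresentedGroup.generated_by _ (Subgroup.comap M.tensorBdry ⁅N, (⊤ : Subgroup G)⁆)
    (fun p => ?_) x
  have h := Subgroup.commutator_mem_commutator (inv_mem (hN p.1)) (Subgroup.mem_top p.2⁻¹)
  rw [commutatorElement_def, inv_inv, inv_inv, ← tensorBdry_tmul] at h
  exact h

end CrossedModule

variable (G : Type u) [Group G]

/-- The `n`-fold tensor power with its structural maps: `G^{⊗1} = G` and
`G^{⊗(n+1)} = G^{⊗n} ⊗ G`, where `G` acts diagonally on `G^{⊗n}` and `G^{⊗n}` acts on `G` by
`g ^ t = g ^ (λ_n t)`. (The value at `n = 0` is irrelevant.) -/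
def powerModule : ℕ → CrossedModule G
  | 0 => CrossedModule.refl G
  | 1 => CrossedModule.refl G
  | n + 2 => (powerModule (n + 1)).tensor

/-- The `n`-fold non-abelian tensor power `G^{⊗n}`, for `n ≥ 1`. -/
abbrev Power (n : ℕ) : Type u := (powerModule G n).T

/-- The lower central series `γ_n(G)`, `n ≥ 1`, with `γ_1(G) = G` and `γ_{n+1}(G) = [γ_n(G), G]`. -/
abbrev gamma (n : ℕ) : Subgroup G := (⊤ : Subgroup G).lowerCentralSeries (n - 1)

theorem bdry_mem_gamma : ∀ (n : ℕ) (x : Power G n), (powerModule G n).bdry x ∈ gamma G n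
  | 0, _ => Subgroup.mem_top _
  | 1, _ => Subgroup.mem_top _
  | n + 2, x => by
    have h := (powerModule G (n + 1)).tensorBdry_mem (gamma G (n + 1)) (bdry_mem_gamma (n + 1)) x
    exact h

/-- `λ_n : G^{⊗n} → γ_n(G)`, `((g₁ ⊗ g₂) ⊗ ⋯) ⊗ g_n ↦ [g₁, g₂, …, g_n]` (left-normed, with
`[x, y] = x⁻¹ y⁻¹ x y`). -/
def lambda (n : ℕ) : Power G n →* gamma G n :=
  (powerModule G n).bdry.codRestrict (gamma G n) (bdry_mem_gamma G n)

end NonabelianTensor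

/-! Write `∂` for the boundary of the crossed module `G^{⊗n} → G`; its kernel is the kernel of
`λ_n`. The Peiffer identity makes the kernel central, so commutativity is immediate and only finite
generation needs work.

For `G` free of finite rank, induct on `n`. With `T = G^{⊗n}`, the map `t ⊗ g ↦ t⁻¹ t^g`
(`displacement`) from `T ⊗ G` to `T` respects the boundaries, so it sends the new kernel into the
old one, whose subgroups are finitely generated. On the part it kills, `G` acts trivially
(`diag_eq_mul_tmul`). As the image of `∂` is free, its kernel embeds in the abelianization of the
tensor power. That is a finitely generated module over the image of the group ring of a finitely
generated nilpotent group, hence noetherian by P. Hall's theorem; in it a subgroup with trivial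
action is a submodule, generated as an abelian group by finitely many elements
(`fg_of_act_trivial`).

In general write `G = F/R` with `F` free of finite rank and `R` the normal closure of finitely many
relators. The kernel of `F^{⊗n} → G^{⊗n}` has boundary containing `[R, F, …, F]` with `n - 1` copies
of `F` (`iterComm_ker_le`), and every subgroup of `R` is finitely generated modulo that term
(`exists_finite_le_closure_sup_iterComm`). Lifts of finitely many elements of `R ∩ im ∂`, together
with generators of the kernel for `F`, map to generators of the kernel for `G`. -/

open scoped commutatorElement

namespace NonabelianTensor

universe u v

/-! ### Hilbert's basis theorem for twisted Laurent extensions. -/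

section LaurentExtension

variable {R S : Type*} [Ring R] [Ring S] (f : R →+* S) (u : Sˣ)

/-- The sums `∑ i < n, u ^ i * f (r i)`. -/
def polyLT : ℕ → AddSubgroup S
  | 0 => ⊥
  | n + 1 => polyLT n ⊔ ((AddMonoidHom.mulLeft ((u : S) ^ n)).comp f.toAddMonoidHom).range

variable {f u}

theorem mem_polyLT_succ {n : ℕ} {x : S} :
    x ∈ polyLT f u (n + 1) ↔ ∃ y ∈ polyLT f u n, ∃ r, y + (u : S) ^ n * f r = x := by
  simp [polyLT, AddSubgroup.mem_sup]

theorem polyLT_mono : Monotone (polyLT f u) :=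
  monotone_nat_of_le_succ fun _ => le_sup_left

theorem mul_mem_polyLT (hu : ∀ r, ∃ r', f r * (u : S) = u * f r') (r : R) {n : ℕ} {x : S}
    (hx : x ∈ polyLT f u n) : f r * x ∈ polyLT f u n := by
  have hpow : ∀ n : ℕ, ∀ r, ∃ r', f r * (u : S) ^ n = (u : S) ^ n * f r' := by
    intro n
    induction n with
    | zero => exact fun r => ⟨r, by simp⟩
    | succ n ih =>
      intro r
      obtain ⟨r₁, h₁⟩ := ih r
      obtain ⟨r₂, h₂⟩ := hu r₁
      exact ⟨r₂, by rw [pow_succ, ← mul_assoc, h₁, mul_assoc, h₂, mul_assoc]⟩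
  induction n generalizing x with
  | zero => rw [(AddSubgroup.mem_bot.1 hx : x = 0), mul_zero]; exact zero_mem _
  | succ n ih =>
    obtain ⟨y, hy, s, rfl⟩ := mem_polyLT_succ.1 hx
    obtain ⟨r', h⟩ := hpow n r
    refine mem_polyLT_succ.2 ⟨f r * y, ih hy, r' * s, ?_⟩
    rw [mul_add, ← mul_assoc (f r), h, map_mul, mul_assoc]

theorem unit_mul_mem_polyLT {n : ℕ} {x : S} (hx : x ∈ polyLT f u n) :
    (u : S) * x ∈ polyLT f u (n + 1) := by
  induction n generalizing x with
  | zero => rw [(AddSubgroup.mem_bot.1 hx : x = 0), mul_zero]; exact zero_mem _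
  | succ n ih =>
    obtain ⟨y, hy, s, rfl⟩ := mem_polyLT_succ.1 hx
    refine mem_polyLT_succ.2 ⟨u * y, ih hy, s, ?_⟩
    rw [mul_add, pow_succ', mul_assoc]

theorem pow_mul_mem_polyLT (k : ℕ) {n : ℕ} {x : S} (hx : x ∈ polyLT f u n) :
    (u : S) ^ k * x ∈ polyLT f u (n + k) := by
  induction k with
  | zero => simpa using hx
  | succ k ih => rw [pow_succ', mul_assoc, ← add_assoc]; exact unit_mul_mem_polyLT ih

theorem exists_pow_mul_eq (hu' : ∀ r, ∃ r', (u : S) * f r = f r' * u) (n : ℕ) :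
    ∀ r, ∃ r', (u : S) ^ n * f r = f r' * (u : S) ^ n := by
  induction n with
  | zero => exact fun r => ⟨r, by simp⟩
  | succ n ih =>
    intro r
    obtain ⟨r₁, h₁⟩ := ih r
    obtain ⟨r₂, h₂⟩ := hu' r₁
    exact ⟨r₂, by rw [pow_succ', mul_assoc, h₁, ← mul_assoc, h₂, mul_assoc]⟩

/-- Every element becomes a polynomial after multiplication by a power of `u`. -/
theorem exists_pow_mul_mem_polyLT (hu : ∀ r, ∃ r', f r * (u : S) = u * f r')
    (hu' : ∀ r, ∃ r', (u : S) * f r = f r' * u)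
    (hS : ∀ V : Subring S, (∀ r, f r ∈ V) → (u : S) ∈ V → ((u⁻¹ : Sˣ) : S) ∈ V → V = ⊤) (x : S) :
    ∃ k n, (u : S) ^ k * x ∈ polyLT f u n := by
  let V : AddSubgroup S :=
    { carrier := {x | ∃ k n, (u : S) ^ k * x ∈ polyLT f u n}
      zero_mem' := ⟨0, 0, by simp⟩
      add_mem' := by
        rintro a b ⟨k, n, h⟩ ⟨k', n', h'⟩
        refine ⟨k + k', (n + k') + (n' + k), ?_⟩
        rw [mul_add]
        refine add_mem (polyLT_mono (Nat.le_add_right _ _) ?_)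
          (polyLT_mono (Nat.le_add_left _ _) ?_)
        · rw [add_comm k k', pow_add, mul_assoc]; exact pow_mul_mem_polyLT _ h
        · rw [pow_add, mul_assoc]; exact pow_mul_mem_polyLT _ h'
      neg_mem' := by
        rintro a ⟨k, n, h⟩
        exact ⟨k, n, by rw [mul_neg]; exact neg_mem h⟩ }
  -- `V` is only known to be an additive group; the elements multiplying `V` into itself form a
  -- subring, which can be compared with the generators of `S`.
  let W : Subring S :=
    { carrier := {s | ∀ v ∈ V, s * v ∈ V}
      one_mem' := fun v hv => by simpa using hv
      zero_mem' := fun v hv => by rw [zero_mul]; exact zero_mem V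
      mul_mem' := fun {a b} ha hb v hv => by rw [mul_assoc]; exact ha _ (hb _ hv)
      add_mem' := fun {a b} ha hb v hv => by rw [add_mul]; exact add_mem (ha _ hv) (hb _ hv)
      neg_mem' := fun {a} ha v hv => by rw [neg_mul]; exact neg_mem (ha _ hv) }
  have hW : W = ⊤ := by
    refine hS W ?_ ?_ ?_
    · rintro r v ⟨k, n, h⟩
      obtain ⟨r', h'⟩ := exists_pow_mul_eq hu' k r
      exact ⟨k, n, by rw [← mul_assoc, h', mul_assoc]; exact mul_mem_polyLT hu _ h⟩
    · rintro v ⟨k, n, h⟩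
      exact ⟨k, n + 1, by
        rw [← mul_assoc, ← pow_succ, pow_succ', mul_assoc]; exact unit_mul_mem_polyLT h⟩
    · rintro v ⟨k, n, h⟩
      exact ⟨k + 1, n, by rw [pow_succ, mul_assoc, Units.mul_inv_cancel_left]; exact h⟩
  have h1 : (1 : S) ∈ V := ⟨0, 1, mem_polyLT_succ.2 ⟨0, zero_mem _, 1, by simp⟩⟩
  have hx : x ∈ W := hW ▸ Subring.mem_top x
  have := hx 1 h1
  rwa [mul_one] at this

/-- The left ideal of coefficients of `u ^ n` in the polynomials of degree at most `n` in `I`. -/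
def leadingCoeffs (hu : ∀ r, ∃ r', f r * (u : S) = u * f r')
    (hu' : ∀ r, ∃ r', (u : S) * f r = f r' * u) (I : Ideal S) (n : ℕ) : Ideal R where
  carrier := {r | ∃ y ∈ polyLT f u n, y + (u : S) ^ n * f r ∈ I}
  zero_mem' := ⟨0, zero_mem _, by simp⟩
  add_mem' := by
    rintro a b ⟨y, hy, h⟩ ⟨z, hz, h'⟩
    refine ⟨y + z, add_mem hy hz, ?_⟩
    rw [map_add, mul_add, add_add_add_comm]
    exact add_mem h h'
  smul_mem' := by
    rintro c r ⟨y, hy, h⟩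
    obtain ⟨c', hc⟩ := exists_pow_mul_eq hu' n c
    refine ⟨f c' * y, mul_mem_polyLT hu _ hy, ?_⟩
    rw [smul_eq_mul, map_mul, ← mul_assoc, hc, mul_assoc, ← mul_add]
    exact I.mul_mem_left _ h

theorem leadingCoeffs_mono (hu : ∀ r, ∃ r', f r * (u : S) = u * f r')
    (hu' : ∀ r, ∃ r', (u : S) * f r = f r' * u) {I J : Ideal S} (hIJ : I ≤ J) {m n : ℕ}
    (hmn : m ≤ n) : leadingCoeffs hu hu' I m ≤ leadingCoeffs hu hu' J n := by
  have step : Monotone (leadingCoeffs hu hu' I) := by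
    refine monotone_nat_of_le_succ fun n => ?_
    rintro r ⟨y, hy, h⟩
    refine ⟨u * y, unit_mul_mem_polyLT hy, ?_⟩
    rw [pow_succ', mul_assoc, ← mul_add]
    exact I.mul_mem_left _ h
  refine (step hmn).trans ?_
  rintro r ⟨y, hy, h⟩
  exact ⟨y, hy, hIJ h⟩

/-- For polynomials, subtract an element of `I` with the same leading term and induct on the degree.
A power of the unit `u` clears denominators, so polynomials determine the ideal. -/
theorem eq_of_leadingCoeffs_eq (hu : ∀ r, ∃ r', f r * (u : S) = u * f r')
    (hu' : ∀ r, ∃ r', (u : S) * f r = f r' * u)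
    (hS : ∀ V : Subring S, (∀ r, f r ∈ V) → (u : S) ∈ V → ((u⁻¹ : Sˣ) : S) ∈ V → V = ⊤)
    {I J : Ideal S} (hIJ : I ≤ J) (h : ∀ n, leadingCoeffs hu hu' I n = leadingCoeffs hu hu' J n) :
    I = J := by
  have key : ∀ n x, x ∈ polyLT f u n → x ∈ J → x ∈ I := by
    intro n
    induction n with
    | zero =>
      intro x hx _
      rw [(AddSubgroup.mem_bot.1 hx : x = 0)]
      exact zero_mem _
    | succ n ih =>
      intro x hx hJ
      obtain ⟨y, hy, r, rfl⟩ := mem_polyLT_succ.1 hx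
      have hr : r ∈ leadingCoeffs hu hu' J n := ⟨y, hy, hJ⟩
      rw [← h] at hr
      obtain ⟨z, hz, hI⟩ := hr
      have hd : y - z ∈ I := ih _ (sub_mem hy hz) (by
        have := J.sub_mem hJ (hIJ hI)
        rwa [add_sub_add_right_eq_sub] at this)
      have := add_mem hd hI
      rwa [← add_assoc, sub_add_cancel] at this
  refine le_antisymm hIJ fun x hx => ?_
  obtain ⟨k, n, hk⟩ := exists_pow_mul_mem_polyLT hu hu' hS x
  have := I.mul_mem_left ((u⁻¹ ^ k : Sˣ) : S) (key n _ hk (J.mul_mem_left _ hx))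
  rwa [← Units.val_pow_eq_pow_val, ← mul_assoc, ← Units.val_mul, inv_pow, inv_mul_cancel,
    Units.val_one, one_mul] at this

/-- A ring generated by the image of a left noetherian ring and a unit normalising that image is
left noetherian. -/
theorem isNoetherianRing_of_unit [IsNoetherianRing R]
    (hu : ∀ r, ∃ r', f r * (u : S) = u * f r') (hu' : ∀ r, ∃ r', (u : S) * f r = f r' * u)
    (hS : ∀ V : Subring S, (∀ r, f r ∈ V) → (u : S) ∈ V → ((u⁻¹ : Sˣ) : S) ∈ V → V = ⊤) :
    IsNoetherianRing S := by
  rw [isNoetherianRing_iff, ← monotone_stabilizes_iff_noetherian]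
  intro I
  have stab : ∀ c : ℕ →o Ideal R, ∃ n, ∀ m, n ≤ m → c n = c m :=
    monotone_stabilizes_iff_noetherian.2 ‹_›
  -- The diagonal chain, where ideal and degree grow together, controls all degrees from `N` on;
  -- each of the finitely many lower degrees has its own bound `B n`.
  obtain ⟨N, hN⟩ := stab ⟨fun k => leadingCoeffs hu hu' (I k) k,
    fun i j hij => leadingCoeffs_mono hu hu' (I.monotone hij) hij⟩
  choose B hB using fun n => stab ⟨fun k => leadingCoeffs hu hu' (I k) n,
    fun i j hij => leadingCoeffs_mono hu hu' (I.monotone hij) le_rfl⟩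
  let K := N + ∑ n ∈ Finset.range N, B n
  refine ⟨K, fun m hm => eq_of_leadingCoeffs_eq hu hu' hS (I.monotone hm) fun n => ?_⟩
  have hNK : N ≤ K := Nat.le_add_right _ _
  rcases lt_or_ge n N with hn | hn
  · have hBK : B n ≤ K := (Finset.single_le_sum (f := B) (fun _ _ => Nat.zero_le _)
      (Finset.mem_range.2 hn)).trans (Nat.le_add_left _ _)
    exact (hB n K hBK).symm.trans (hB n m (hBK.trans hm))
  · have key : ∀ k, N ≤ k → leadingCoeffs hu hu' (I k) n = leadingCoeffs hu hu' (I N) N := by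
      intro k hk
      refine le_antisymm ?_ (leadingCoeffs_mono hu hu' (I.monotone hk) hn)
      refine (leadingCoeffs_mono hu hu' (I.monotone (le_max_left k n)) (le_max_right k n)).trans ?_
      exact (hN (max k n) (hn.trans (le_max_right _ _))).ge
    rw [key K hNK, key m (hNK.trans hm)]

end LaurentExtension

/-! ### Subrings generated by images of groups. -/

section GroupRing

variable {P S : Type*} [Group P] [Ring S] (ρ : P →* S)

/-- The subring generated by the image of a subgroup. -/
def groupSubring (H : Subgroup P) : Subring S := Subring.closure (ρ '' H)

variable {ρ}

theorem groupSubring_mono {H K : Subgroup P} (h : H ≤ K) :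
    groupSubring ρ H ≤ groupSubring ρ K :=
  Subring.closure_mono (Set.image_mono h)

theorem mem_groupSubring {H : Subgroup P} {h : P} (hh : h ∈ H) : ρ h ∈ groupSubring ρ H :=
  Subring.subset_closure ⟨h, hh, rfl⟩

theorem conj_mem_groupSubring {H : Subgroup P} {z : P} (hz : ∀ h ∈ H, z * h * z⁻¹ ∈ H) {s : S}
    (hs : s ∈ groupSubring ρ H) : ρ z * s * ρ z⁻¹ ∈ groupSubring ρ H := by
  have e : ρ z⁻¹ * ρ z = 1 := by rw [← map_mul, inv_mul_cancel, map_one]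
  induction hs using Subring.closure_induction with
  | mem x hx =>
    obtain ⟨h, hh, rfl⟩ := hx
    rw [← map_mul, ← map_mul]
    exact mem_groupSubring (hz h hh)
  | zero => simp
  | one => rw [mul_one, ← map_mul, mul_inv_cancel, map_one]; exact one_mem _
  | add x y _ _ hx hy => rw [mul_add, add_mul]; exact add_mem hx hy
  | neg x _ hx => rw [mul_neg, neg_mul]; exact neg_mem hx
  | mul x y _ _ hx hy =>
    have : ρ z * (x * y) * ρ z⁻¹ = ρ z * x * ρ z⁻¹ * (ρ z * y * ρ z⁻¹) := by
      simp only [mul_assoc, ← mul_assoc (ρ z⁻¹) (ρ z), e, one_mul]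
    rw [this]
    exact mul_mem hx hy

/-- Since `z` normalises `H`, the unit `ρ z` normalises the ring of `H`, and the twisted Laurent
extension theorem applies. -/
theorem isNoetherianRing_groupSubring_sup {H : Subgroup P} [IsNoetherianRing (groupSubring ρ H)]
    {z : P} (hz : ∀ h ∈ H, z * h * z⁻¹ ∈ H) (hz' : ∀ h ∈ H, z⁻¹ * h * z ∈ H) :
    IsNoetherianRing (groupSubring ρ (H ⊔ Subgroup.zpowers z)) := by
  have hzm : z ∈ H ⊔ Subgroup.zpowers z := Subgroup.mem_sup_right (Subgroup.mem_zpowers z)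
  have e : ρ z⁻¹ * ρ z = 1 := by rw [← map_mul, inv_mul_cancel, map_one]
  have e' : ρ z * ρ z⁻¹ = 1 := by rw [← map_mul, mul_inv_cancel, map_one]
  let u : (groupSubring ρ (H ⊔ Subgroup.zpowers z))ˣ :=
    { val := ⟨ρ z, mem_groupSubring hzm⟩
      inv := ⟨ρ z⁻¹, mem_groupSubring (inv_mem hzm)⟩
      val_inv := Subtype.ext e'
      inv_val := Subtype.ext e }
  refine isNoetherianRing_of_unit (u := u)
    (f := Subring.inclusion (groupSubring_mono (le_sup_left (b := Subgroup.zpowers z)))) ?_ ?_ ?_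
  · rintro ⟨r, hr⟩
    refine ⟨⟨_, conj_mem_groupSubring (z := z⁻¹) (by simpa using hz') hr⟩, Subtype.ext ?_⟩
    change r * ρ z = ρ z * (ρ z⁻¹ * r * ρ z⁻¹⁻¹)
    rw [inv_inv, ← mul_assoc, ← mul_assoc, e', one_mul]
  · rintro ⟨r, hr⟩
    refine ⟨⟨_, conj_mem_groupSubring hz hr⟩, Subtype.ext ?_⟩
    change ρ z * r = ρ z * r * ρ z⁻¹ * ρ z
    rw [mul_assoc _ (ρ z⁻¹), e, mul_one]
  · intro V h1 h2 h3
    have key : ∀ p (hp : p ∈ H ⊔ Subgroup.zpowers z),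
        (⟨ρ p, mem_groupSubring hp⟩ : groupSubring ρ (H ⊔ Subgroup.zpowers z)) ∈ V := by
      intro p hp
      rw [← Subgroup.closure_eq H, Subgroup.zpowers_eq_closure, ← Subgroup.closure_union] at hp
      have hle : Subgroup.closure ((H : Set P) ∪ {z}) ≤ H ⊔ Subgroup.zpowers z := by
        rw [Subgroup.closure_union, Subgroup.closure_eq, Subgroup.zpowers_eq_closure]
      have : ∀ q ∈ (H : Set P) ∪ {z}, ∀ hq : q ∈ H ⊔ Subgroup.zpowers z,
          (⟨ρ q, mem_groupSubring hq⟩ : groupSubring ρ (H ⊔ Subgroup.zpowers z)) ∈ V ∧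
          (⟨ρ q⁻¹, mem_groupSubring (inv_mem hq)⟩ :
            groupSubring ρ (H ⊔ Subgroup.zpowers z)) ∈ V := by
        rintro q (hq | rfl) hq'
        · exact ⟨h1 ⟨ρ q, mem_groupSubring hq⟩, h1 ⟨ρ q⁻¹, mem_groupSubring (inv_mem hq)⟩⟩
        · exact ⟨h2, h3⟩
      have main : ∀ p ∈ Subgroup.closure ((H : Set P) ∪ {z}), ∃ hp : p ∈ H ⊔ Subgroup.zpowers z,
          (⟨ρ p, mem_groupSubring hp⟩ : groupSubring ρ (H ⊔ Subgroup.zpowers z)) ∈ V := by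
        intro p hp
        induction hp using Subgroup.closure_induction'' with
        | mem x hx =>
          exact ⟨hle (Subgroup.subset_closure hx),
            (this x hx (hle (Subgroup.subset_closure hx))).1⟩
        | inv_mem x hx =>
          exact ⟨inv_mem (hle (Subgroup.subset_closure hx)),
            (this x hx (hle (Subgroup.subset_closure hx))).2⟩
        | one => exact ⟨one_mem _, by convert one_mem V; simp⟩
        | mul x y _ _ hx hy =>
          obtain ⟨hx, hx'⟩ := hx
          obtain ⟨hy, hy'⟩ := hy
          exact ⟨mul_mem hx hy, by convert mul_mem hx' hy'; simp⟩
      exact (main p hp).2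
    rw [eq_top_iff]
    rintro ⟨s, hs⟩ -
    have main : ∃ hs : s ∈ groupSubring ρ (H ⊔ Subgroup.zpowers z), (⟨s, hs⟩ :
        groupSubring ρ (H ⊔ Subgroup.zpowers z)) ∈ V := by
      induction hs using Subring.closure_induction with
      | mem x hx =>
        obtain ⟨p, hp, rfl⟩ := hx
        exact ⟨_, key p hp⟩
      | zero => exact ⟨zero_mem _, zero_mem V⟩
      | one => exact ⟨one_mem _, one_mem V⟩
      | add x y _ _ hx hy => exact ⟨add_mem hx.1 hy.1, add_mem hx.2 hy.2⟩
      | neg x _ hx => exact ⟨neg_mem hx.1, neg_mem hx.2⟩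
      | mul x y _ _ hx hy => exact ⟨mul_mem hx.1 hy.1, mul_mem hx.2 hy.2⟩
    exact main.2

theorem isNoetherianRing_groupSubring_of_trivial {H : Subgroup P} (h : ∀ p ∈ H, ρ p = 1) :
    IsNoetherianRing (groupSubring ρ H) := by
  refine isNoetherianRing_of_surjective ℤ _ (Int.castRingHom _) ?_
  rintro ⟨s, hs⟩
  have main : ∃ n : ℤ, (n : S) = s := by
    induction hs using Subring.closure_induction with
    | mem x hx =>
      obtain ⟨p, hp, rfl⟩ := hx
      exact ⟨1, by simp [h p hp]⟩
    | zero => exact ⟨0, by simp⟩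
    | one => exact ⟨1, by simp⟩
    | add x y _ _ hx hy =>
      obtain ⟨a, rfl⟩ := hx
      obtain ⟨b, rfl⟩ := hy
      exact ⟨a + b, by simp⟩
    | neg x _ hx =>
      obtain ⟨a, rfl⟩ := hx
      exact ⟨-a, by simp⟩
    | mul x y _ _ hx hy =>
      obtain ⟨a, rfl⟩ := hx
      obtain ⟨b, rfl⟩ := hy
      exact ⟨a * b, by simp⟩
  obtain ⟨n, rfl⟩ := main
  exact ⟨n, Subtype.ext (by simp)⟩

end GroupRing

/-! ### Finite generation along iterated commutators, and P. Hall's theorem. -/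

section Series

variable {G : Type*} [Group G]

/-- The iterated commutator subgroups `[N, G, …, G]`. -/
def iterComm (N : Subgroup G) : ℕ → Subgroup G
  | 0 => N
  | k + 1 => ⁅iterComm N k, (⊤ : Subgroup G)⁆

instance iterComm_normal (N : Subgroup G) [N.Normal] : ∀ k, (iterComm N k).Normal
  | 0 => ‹_›
  | k + 1 => by
    have := iterComm_normal N k
    exact inferInstanceAs (⁅iterComm N k, (⊤ : Subgroup G)⁆).Normal

theorem iterComm_succ_le (N : Subgroup G) [N.Normal] (k : ℕ) :
    iterComm N (k + 1) ≤ iterComm N k :=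
  Subgroup.commutator_le_left _ _

/-- If `N` is finitely generated modulo `[N, G]` and `G` is finitely generated, then `[N, G]` is
finitely generated modulo `[N, G, G]`. -/
theorem commutator_le_closure_sup {N : Subgroup G} [N.Normal] {X Y : Set G} (hX : X ⊆ N)
    (hY : Subgroup.closure Y = ⊤) (h : N ≤ Subgroup.closure X ⊔ ⁅N, (⊤ : Subgroup G)⁆) :
    ⁅N, (⊤ : Subgroup G)⁆ ≤
      Subgroup.closure (Set.image2 (fun x y => ⁅x, y⁆) X Y) ⊔ ⁅⁅N, (⊤ : Subgroup G)⁆, ⊤⁆ := by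
  set C := ⁅N, (⊤ : Subgroup G)⁆ with hC
  set D := ⁅C, (⊤ : Subgroup G)⁆ with hD
  set W := Subgroup.closure (Set.image2 (fun x y => ⁅x, y⁆) X Y) ⊔ D with hW
  have hDW : D ≤ W := le_sup_right
  have hCN : C ≤ N := Subgroup.commutator_le_left _ _
  -- `C` is central modulo `D`, so commutators of `N` with `G` are bimultiplicative modulo `D`; it
  -- is enough to treat generators in each variable.
  have conj : ∀ w ∈ C, w ∈ W → ∀ g, g * w * g⁻¹ ∈ W := by
    intro w hw hwW g
    have h1 : ⁅w⁻¹, g⁆ ∈ W :=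
      hDW (Subgroup.commutator_mem_commutator (inv_mem hw) (Subgroup.mem_top g))
    have : g * w * g⁻¹ = w * ⁅w⁻¹, g⁆ := by rw [commutatorElement_def]; group
    rw [this]
    exact mul_mem hwW h1
  have memC : ∀ n ∈ N, ∀ g, ⁅n, g⁆ ∈ C := fun n hn g =>
    Subgroup.commutator_mem_commutator hn (Subgroup.mem_top g)
  have hx : ∀ x ∈ X, ∀ g, ⁅x, g⁆ ∈ W := by
    intro x hx g
    have hg : g ∈ Subgroup.closure Y := hY ▸ Subgroup.mem_top g
    induction hg using Subgroup.closure_induction with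
    | mem y hy => exact Subgroup.mem_sup_left (Subgroup.subset_closure ⟨x, hx, y, hy, rfl⟩)
    | one => simp
    | mul a b _ _ ha hb =>
      have : ⁅x, a * b⁆ = ⁅x, a⁆ * (a * ⁅x, b⁆ * a⁻¹) := by
        simp only [commutatorElement_def]; group
      rw [this]
      exact mul_mem ha (conj _ (memC x (hX hx) b) hb a)
    | inv a _ ha =>
      have : ⁅x, a⁻¹⁆ = a⁻¹ * ⁅x, a⁆⁻¹ * a⁻¹⁻¹ := by
        simp only [commutatorElement_def]; group
      rw [this]
      exact conj _ (inv_mem (memC x (hX hx) a)) (inv_mem ha) _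
  let V : Subgroup G :=
    { carrier := {n | n ∈ N ∧ ∀ g, ⁅n, g⁆ ∈ W}
      one_mem' := ⟨one_mem N, fun g => by simp⟩
      mul_mem' := by
        rintro a b ⟨ha, ha'⟩ ⟨hb, hb'⟩
        refine ⟨mul_mem ha hb, fun g => ?_⟩
        have : ⁅a * b, g⁆ = (a * ⁅b, g⁆ * a⁻¹) * ⁅a, g⁆ := by
          simp only [commutatorElement_def]; group
        rw [this]
        exact mul_mem (conj _ (memC b hb g) (hb' g) a) (ha' g)
      inv_mem' := by
        rintro a ⟨ha, ha'⟩
        refine ⟨inv_mem ha, fun g => ?_⟩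
        have : ⁅a⁻¹, g⁆ = a⁻¹ * ⁅a, g⁆⁻¹ * a⁻¹⁻¹ := by
          simp only [commutatorElement_def]; group
        rw [this]
        exact conj _ (inv_mem (memC a ha g)) (inv_mem (ha' g)) _ }
  have hNV : N ≤ V := by
    refine h.trans (sup_le ((Subgroup.closure_le V).2 fun x h => ⟨hX h, hx x h⟩) fun c hc =>
      ⟨hCN hc, fun g => hDW (Subgroup.commutator_mem_commutator hc (Subgroup.mem_top g))⟩)
  exact Subgroup.commutator_le.2 fun n hn g _ => (hNV hn).2 g

theorem exists_finite_iterComm_le {N : Subgroup G} [N.Normal] {X Y : Set G} (hX : X ⊆ N)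
    (hXf : X.Finite) (hYf : Y.Finite) (hY : Subgroup.closure Y = ⊤)
    (h : N ≤ Subgroup.closure X ⊔ ⁅N, (⊤ : Subgroup G)⁆) (k : ℕ) :
    ∃ Z : Set G, Z.Finite ∧ Z ⊆ iterComm N k ∧
      iterComm N k ≤ Subgroup.closure Z ⊔ iterComm N (k + 1) := by
  induction k with
  | zero => exact ⟨X, hXf, hX, h⟩
  | succ k ih =>
    obtain ⟨Z, hZf, hZ, hle⟩ := ih
    refine ⟨Set.image2 (fun x y => ⁅x, y⁆) Z Y, hZf.image2 _ hYf, ?_,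
      commutator_le_closure_sup hZ hY hle⟩
    rintro _ ⟨z, hz, y, _, rfl⟩
    exact Subgroup.commutator_mem_commutator (hZ hz) (Subgroup.mem_top y)

/-- Climbs the lower central series from the term acting trivially, whose ring is a quotient of `ℤ`,
adjoining one generator of a central factor at a time. -/
theorem isNoetherianRing_groupSubring_top {S : Type*} [Ring S] [Group.FG G] (ρ : G →* S) (k : ℕ)
    (h : ∀ g ∈ iterComm (⊤ : Subgroup G) k, ρ g = 1) : IsNoetherianRing (groupSubring ρ ⊤) := by
  obtain ⟨Y, hY, hYf⟩ := (Subgroup.fg_iff (⊤ : Subgroup G)).1 Group.FG.out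
  have h0 := isNoetherianRing_groupSubring_of_trivial h
  clear h
  induction k with
  | zero => exact h0
  | succ k ih =>
    apply ih
    obtain ⟨Z, hZf, hZ, hle⟩ := exists_finite_iterComm_le (N := (⊤ : Subgroup G)) (X := Y)
      (fun _ _ => Subgroup.mem_top _) hYf hYf hY (hY ▸ le_sup_left) k
    have key : IsNoetherianRing (groupSubring ρ (iterComm ⊤ (k + 1) ⊔ Subgroup.closure Z)) := by
      clear hle
      induction Z, hZf using Set.Finite.induction_on with
      | empty => rwa [Subgroup.closure_empty, sup_bot_eq]
      | @insert z Z _ _ ihZ =>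
        have := ihZ ((Set.subset_insert _ _).trans hZ)
        rw [Set.insert_eq, Set.union_comm, Subgroup.closure_union,
          ← Subgroup.zpowers_eq_closure, ← sup_assoc]
        -- Each commutator `⁅w, h⁆` already lies in the next term, so `w` normalises every
        -- intermediate subgroup.
        have conj : ∀ w ∈ iterComm (⊤ : Subgroup G) k,
            ∀ h ∈ iterComm (⊤ : Subgroup G) (k + 1) ⊔ Subgroup.closure Z,
            w * h * w⁻¹ ∈ iterComm (⊤ : Subgroup G) (k + 1) ⊔ Subgroup.closure Z := by
          intro w hw h hh
          have : w * h * w⁻¹ = ⁅w, h⁆ * h := by rw [commutatorElement_def]; group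
          rw [this]
          exact mul_mem (Subgroup.mem_sup_left
            (Subgroup.commutator_mem_commutator hw (Subgroup.mem_top h))) hh
        have hz := hZ (Set.mem_insert z Z)
        refine isNoetherianRing_groupSubring_sup (conj z hz) fun h hh => ?_
        simpa using conj z⁻¹ (inv_mem hz) h hh
    have e : iterComm (⊤ : Subgroup G) k = iterComm ⊤ (k + 1) ⊔ Subgroup.closure Z :=
      le_antisymm (hle.trans (sup_comm _ _).le)
        (sup_le (iterComm_succ_le _ k) ((Subgroup.closure_le _).2 hZ))
    rwa [e]

theorem fg_of_le_of_commute {N K : Subgroup G} (hN : N.FG) (hc : ∀ a ∈ N, ∀ b ∈ N, a * b = b * a)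
    (h : K ≤ N) : K.FG := by
  let _ : CommGroup N := { (inferInstance : Group N) with
    mul_comm := fun a b => Subtype.ext (hc a a.2 b b.2) }
  have : Group.FG N := (Group.fg_iff_subgroup_fg N).2 hN
  have hfin : Module.Finite ℤ (Additive N) := Module.Finite.iff_addGroup_fg.2 inferInstance
  have hK : (AddSubgroup.toIntSubmodule (Subgroup.toAddSubgroup (K.subgroupOf N))).FG :=
    IsNoetherian.noetherian _
  have hK' : (K.subgroupOf N).FG := by
    rw [Subgroup.fg_iff_add_fg]
    exact (Submodule.fg_iff_addSubgroup_fg _).1 hK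
  obtain ⟨S, hS, hSf⟩ := (Subgroup.fg_iff _).1 hK'
  refine (Subgroup.fg_iff _).2 ⟨N.subtype '' S, ?_, hSf.image _⟩
  rw [← MonoidHom.map_closure, hS, Subgroup.map_subgroupOf_eq_of_le h]

/-- A subgroup of a group that is finitely generated and central modulo `M` is finitely generated
modulo `M`. -/
theorem exists_finite_le_closure_sup {N M : Subgroup G} [M.Normal] {Z : Set G} (hZf : Z.Finite)
    (hc : ⁅N, N⁆ ≤ M) (hZ : Z ⊆ N) (hN : N ≤ Subgroup.closure Z ⊔ M) {H : Subgroup G}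
    (hH : H ≤ N) : ∃ Y : Set G, Y.Finite ∧ Y ⊆ H ∧ H ≤ Subgroup.closure Y ⊔ M := by
  let q := QuotientGroup.mk' M
  have hNmap : N.map q = Subgroup.closure (q '' Z) := by
    rw [← MonoidHom.map_closure]
    refine le_antisymm ?_ (Subgroup.map_mono ((Subgroup.closure_le N).2 hZ))
    refine (Subgroup.map_mono hN).trans ?_
    rw [Subgroup.map_sup, (Subgroup.map_eq_bot_iff (f := q) M).2 (by simp [q]), sup_bot_eq]
  have hfg : (H.map q).FG := by
    refine fg_of_le_of_commute (N := N.map q)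
      (hNmap ▸ (Subgroup.fg_iff _).2 ⟨_, rfl, hZf.image q⟩) ?_ (Subgroup.map_mono hH)
    rintro _ ⟨a, ha, rfl⟩ _ ⟨b, hb, rfl⟩
    rw [← commutatorElement_eq_one_iff_mul_comm, ← map_commutatorElement]
    exact (QuotientGroup.eq_one_iff _).2 (hc (Subgroup.commutator_mem_commutator ha hb))
  obtain ⟨S, hS, hSf⟩ := (Subgroup.fg_iff _).1 hfg
  have hSH : S ⊆ q '' (H : Set G) := fun s hs => by
    have : s ∈ H.map q := hS ▸ Subgroup.subset_closure hs
    exact this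
  choose! r hrH hr using hSH
  have hrS : q '' (r '' S) = S := by
    rw [Set.image_image]
    exact (Set.image_congr hr).trans (Set.image_id _)
  refine ⟨r '' S, hSf.image _, Set.image_subset_iff.2 hrH, fun h hh => ?_⟩
  have : q h ∈ (Subgroup.closure (r '' S)).map q := by
    rw [MonoidHom.map_closure, hrS, hS]
    exact Subgroup.mem_map_of_mem q hh
  obtain ⟨y, hy, e⟩ := this
  rw [← mul_inv_cancel_left y h]
  exact mul_mem (Subgroup.mem_sup_left hy) (Subgroup.mem_sup_right (QuotientGroup.eq.1 e))

/-- Each factor of the series is a finitely generated abelian group, so `H` meets it in a finitely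
generated subgroup; these generators are collected term by term. -/
theorem exists_finite_le_closure_sup_iterComm {N : Subgroup G} [N.Normal] {X Y : Set G}
    (hX : X ⊆ N) (hXf : X.Finite) (hYf : Y.Finite) (hY : Subgroup.closure Y = ⊤)
    (h : N ≤ Subgroup.closure X ⊔ ⁅N, (⊤ : Subgroup G)⁆) {H : Subgroup G} (hH : H ≤ N) (k : ℕ) :
    ∃ Z : Set G, Z.Finite ∧ Z ⊆ H ∧ H ≤ Subgroup.closure Z ⊔ iterComm N k := by
  induction k with
  | zero => exact ⟨∅, Set.finite_empty, Set.empty_subset _, hH.trans le_sup_right⟩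
  | succ k ih =>
    obtain ⟨Z, hZf, hZH, hZ⟩ := ih
    obtain ⟨U, hUf, hUN, hU⟩ := exists_finite_iterComm_le hX hXf hYf hY h k
    obtain ⟨V, hVf, hVH, hV⟩ := exists_finite_le_closure_sup (M := iterComm N (k + 1)) hUf
      (Subgroup.commutator_mono le_rfl le_top) hUN hU (inf_le_right (a := H))
    refine ⟨Z ∪ V, hZf.union hVf, Set.union_subset hZH (hVH.trans inf_le_left), fun x hx => ?_⟩
    obtain ⟨a, ha, b, hb, rfl⟩ := Subgroup.mem_sup_of_normal_right.1 (hZ hx)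
    have hb' : b ∈ H ⊓ iterComm N k :=
      ⟨(H.mul_mem_cancel_left ((Subgroup.closure_le H).2 hZH ha)).1 hx, hb⟩
    rw [Subgroup.closure_union, sup_assoc]
    exact mul_mem (Subgroup.mem_sup_left ha) (Subgroup.mem_sup_right (hV hb'))

end Series

theorem fg_of_fg_map_of_fg_inf_ker {G H : Type*} [Group G] [Group H] (f : G →* H) {K : Subgroup G}
    (h : (K.map f).FG) (h' : (K ⊓ f.ker).FG) : K.FG := by
  obtain ⟨S, hS, hSf⟩ := (Subgroup.fg_iff _).1 h
  obtain ⟨T, hT, hTf⟩ := (Subgroup.fg_iff _).1 h'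
  have hSK : ∀ s ∈ S, ∃ x, x ∈ K ∧ f x = s := fun s hs =>
    (show s ∈ K.map f from hS ▸ Subgroup.subset_closure hs)
  choose! r hrK hr using hSK
  have hrS : f '' (r '' S) = S := by
    rw [Set.image_image]
    exact (Set.image_congr hr).trans (Set.image_id _)
  have hT' : Subgroup.closure T ≤ Subgroup.closure (r '' S ∪ T) :=
    Subgroup.closure_mono Set.subset_union_right
  refine (Subgroup.fg_iff _).2 ⟨r '' S ∪ T, le_antisymm ?_ fun x hx => ?_,
    (hSf.image _).union hTf⟩
  · rw [Subgroup.closure_union, hT]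
    exact sup_le ((Subgroup.closure_le _).2 (Set.image_subset_iff.2 hrK)) inf_le_left
  · have : f x ∈ (Subgroup.closure (r '' S)).map f := by
      rw [MonoidHom.map_closure, hrS, hS]
      exact Subgroup.mem_map_of_mem f hx
    obtain ⟨y, hy, e⟩ := this
    have hyK : y ∈ K := (Subgroup.closure_le K).2 (Set.image_subset_iff.2 hrK) hy
    rw [← mul_inv_cancel_left y x]
    refine mul_mem (Subgroup.closure_mono Set.subset_union_left hy) (hT' ?_)
    rw [hT]
    exact ⟨K.mul_mem (K.inv_mem hyK) hx, MonoidHom.mem_ker.2 (by simp [e])⟩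

/-! ### Displacement, equivariant finite generation and abelianization of a crossed module. -/

namespace CrossedModule

variable {G : Type u} [Group G] (M : CrossedModule G)

theorem commute_of_bdry_eq_one {s : M.T} (hs : M.bdry s = 1) (t : M.T) : s * t = t * s := by
  have := M.peiffer s t
  rw [hs, op_one, map_one, MulAut.one_apply, mul_assoc, eq_inv_mul_iff_mul_eq] at this
  exact this

/-- The homomorphism `T ⊗ G → T`, `t ⊗ g ↦ t⁻¹ t ^ g`. -/
def displacement : M.tensorType →* M.T :=
  Tensor.lift (fun t g => t⁻¹ * M.act (op g) t)
    (fun t s g => by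
      have e : M.act (op ((M.bdry s)⁻¹ * g * M.bdry s)) (s⁻¹ * t * s) =
          s⁻¹ * M.act (op g) t * s := by
        rw [← M.peiffer s t, M.act_act, ← M.peiffer s, M.act_act]
        group
      rw [coact_apply, e, map_mul]
      group)
    (fun t g h => by
      rw [M.act_act, show h * (h⁻¹ * g * h) = g * h by group]
      group)

@[simp] theorem displacement_tmul (t : M.T) (g : G) :
    M.displacement (tmul M.act M.coact t g) = t⁻¹ * M.act (op g) t :=
  Tensor.lift_tmul ..

theorem bdry_displacement (x : M.tensorType) : M.bdry (M.displacement x) = M.tensorBdry x := by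
  have : M.bdry.comp M.displacement = M.tensorBdry :=
    Tensor.hom_ext fun t g => by simp [M.bdry_act, mul_assoc]
  exact DFunLike.congr_fun this x

theorem tmul_one (t : M.T) : tmul M.act M.coact t 1 = 1 := by
  have := tmul_mul_right (a := M.act) (b := M.coact) t 1 1
  simpa using this

theorem one_tmul (g : G) : tmul M.act M.coact 1 g = 1 := by
  have := tmul_mul_left (a := M.act) (b := M.coact) 1 1 g
  simpa using this

theorem tmul_mul_right' (t : M.T) (g h : G) : tmul M.act M.coact t (g * h) =
    tmul M.act M.coact t h * M.diag h (tmul M.act M.coact t g) := by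
  rw [tmul_mul_right, diag_tmul]

theorem tmul_mul_left' (t s : M.T) (g : G) : tmul M.act M.coact (t * s) g =
    M.diag (M.bdry s) (tmul M.act M.coact t g) * tmul M.act M.coact s g := by
  rw [tmul_mul_left, diag_tmul, M.peiffer, coact_apply]

/-- The action of `G` on `T ⊗ G` is controlled by the homomorphism `T ⊗ G → T`. -/
theorem diag_eq_mul_tmul (x : M.tensorType) (g : G) :
    M.diag g x = x * tmul M.act M.coact (M.displacement x) g := by
  let S : Subgroup M.tensorType :=
    { carrier := {x | M.diag g x = x * tmul M.act M.coact (M.displacement x) g}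
      one_mem' := by simp [one_tmul]
      mul_mem' := fun {x y} hx hy => by
        simp only [Set.mem_ofPred_eq, map_mul] at *
        rw [hx, hy, tmul_mul_left', bdry_displacement, tensor_peiffer]
        group
      inv_mem' := fun {x} hx => by
        simp only [Set.mem_ofPred_eq, map_inv] at *
        have h := M.tmul_mul_left' (M.displacement x)⁻¹ (M.displacement x) g
        rw [inv_mul_cancel, one_tmul, bdry_displacement, tensor_peiffer, mul_assoc,
          eq_comm] at h
        rw [hx, eq_inv_of_mul_eq_one_left h] }
  refine PresentedGroup.generated_by _ S (fun p => ?_) x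
  change M.diag g (tmul M.act M.coact p.1 p.2) = tmul M.act M.coact p.1 p.2 *
    tmul M.act M.coact (M.displacement (tmul M.act M.coact p.1 p.2)) g
  obtain ⟨t, h⟩ := p
  have e₁ := M.tmul_mul_left' t (M.displacement (tmul M.act M.coact t h)) g
  rw [bdry_displacement, tensor_peiffer, displacement_tmul, mul_inv_cancel_left] at e₁
  -- Compare two expansions of `t ⊗ hg`: directly, and as `t ⊗ (h g h⁻¹) h`, where `t^h ⊗ g` appears
  -- and is expanded by `e₁` through `t^h = t (t⁻¹ t^h)`.
  have e₂ := M.tmul_mul_right' t h g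
  have e₃ := M.tmul_mul_right' t (h * g * h⁻¹) h
  rw [inv_mul_cancel_right, diag_tmul, show h⁻¹ * (h * g * h⁻¹) * h = g by group, e₁, e₂] at e₃
  simp only [mul_assoc, mul_inv_cancel_left] at e₃
  rw [displacement_tmul]
  exact mul_left_cancel e₃

/-- `T` is finitely generated as a group with an action of `G`. -/
def ActFG : Prop :=
  ∃ Y : Set M.T, Y.Finite ∧ ∀ W : Subgroup M.T,
    (∀ g, ∀ w ∈ W, M.act (op g) w ∈ W) → Y ⊆ W → W = ⊤

variable {M}

/-- The symbols `y ⊗ x` on the two finite generating sets suffice, because the tensor relations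
expand products up to the diagonal action. -/
theorem actFG_tensor [Group.FG G] (h : M.ActFG) : M.tensor.ActFG := by
  obtain ⟨Y, hYf, hY⟩ := h
  obtain ⟨X, hX, hXf⟩ := Group.fg_iff.1 ‹Group.FG G›
  refine ⟨Set.image2 (tmul M.act M.coact) Y X, hYf.image2 _ hXf, fun (W : Subgroup M.tensorType)
    (hW : ∀ g, ∀ w ∈ W, M.diag g w ∈ W) hYX => ?_⟩
  have h1 : ∀ y ∈ Y, ∀ g, tmul M.act M.coact y g ∈ W := by
    intro y hy g
    have hg : g ∈ Subgroup.closure X := hX ▸ Subgroup.mem_top g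
    induction hg using Subgroup.closure_induction with
    | mem x hx => exact hYX ⟨y, hy, x, hx, rfl⟩
    | one => rw [tmul_one]; exact one_mem W
    | mul a b _ _ ha hb => rw [tmul_mul_right']; exact mul_mem hb (hW b _ ha)
    | inv a _ ha =>
      have e := M.tmul_mul_right' y a a⁻¹
      rw [mul_inv_cancel, tmul_one, eq_comm] at e
      rw [eq_inv_of_mul_eq_one_left e]
      exact inv_mem (hW _ _ ha)
  let V : Subgroup M.T :=
    { carrier := {t | ∀ g, tmul M.act M.coact t g ∈ W}
      one_mem' := fun g => by rw [one_tmul]; exact one_mem W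
      mul_mem' := fun {a b} ha hb g => by
        rw [tmul_mul_left']; exact mul_mem (hW _ _ (ha g)) (hb g)
      inv_mem' := fun {a} ha g => by
        have e := M.tmul_mul_left' a a⁻¹ g
        rw [mul_inv_cancel, one_tmul, eq_comm] at e
        rw [eq_inv_of_mul_eq_one_right e]
        exact inv_mem (hW _ _ (ha g)) }
  have hV : V = ⊤ := by
    refine hY V (fun g t ht x => ?_) fun y hy => h1 y hy
    have := hW g _ (ht (g * x * g⁻¹))
    rwa [diag_tmul, show g⁻¹ * (g * x * g⁻¹) * g = x by group] at this
  refine eq_top_iff.2 fun x _ => ?_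
  refine PresentedGroup.generated_by _ W (fun p => ?_) x
  exact (hV ▸ Subgroup.mem_top p.1 : p.1 ∈ V) p.2

theorem actFG_refl [Group.FG G] : (refl G).ActFG := by
  obtain ⟨X, hX, hXf⟩ := Group.fg_iff.1 ‹Group.FG G›
  refine ⟨X, hXf, fun W _ hW => ?_⟩
  rw [eq_top_iff]
  exact hX.ge.trans ((Subgroup.closure_le W).2 hW)

variable (M)

/-- If the image of `∂` is free, then its kernel embeds in the abelianization of `T`. -/
theorem eq_one_of_abelianization_eq_one [IsFreeGroup G] {t : M.T} (ht : M.bdry t = 1)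
    (h : Abelianization.of t = 1) : t = 1 := by
  choose r hr using M.bdry.rangeRestrict_surjective
  -- The range of `∂` is free by Nielsen–Schreier, so `∂` splits over it. Then `c` below retracts
  -- `T` onto the central kernel; a homomorphism to an abelian group kills commutators, yet `c`
  -- fixes the kernel.
  let s : M.bdry.range →* M.T := IsFreeGroup.lift fun a => r (IsFreeGroup.of a)
  have hs : ∀ b, M.bdry (s b) = b := by
    have : M.bdry.rangeRestrict.comp s = MonoidHom.id _ := IsFreeGroup.ext_hom fun a => by
      simp [s, hr]
    intro b
    exact congrArg Subtype.val (DFunLike.congr_fun this b)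
  let c : M.T → M.T := fun t => t * (s (M.bdry.rangeRestrict t))⁻¹
  have hc : ∀ t, M.bdry (c t) = 1 := fun t => by simp [c, hs]
  let φ : M.T →* M.T := MonoidHom.mk' c fun x y => by
    have e := M.commute_of_bdry_eq_one (hc y) (s (M.bdry.rangeRestrict x))⁻¹
    simp only [c, map_mul, mul_inv_rev] at e ⊢
    simp only [mul_assoc] at e ⊢
    rw [e]
  have hk : commutator M.T ≤ φ.ker := by
    rw [commutator_def, Subgroup.commutator_le]
    intro a _ b _
    rw [MonoidHom.mem_ker, map_commutatorElement, commutatorElement_eq_one_iff_mul_comm]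
    exact M.commute_of_bdry_eq_one (hc a) _
  have ht' : t ∈ commutator M.T := by rwa [← Abelianization.ker_of, MonoidHom.mem_ker]
  have : c t = 1 := hk ht'
  have e : M.bdry.rangeRestrict t = 1 := Subtype.ext ht
  simpa [c, e] using this

/-- The action of `G` on the abelianization of `T`, made into a left action. -/
def abelianizationAction : G →* AddMonoid.End (Additive (Abelianization M.T)) where
  toFun g := MonoidHom.toAdditive (Abelianization.map (M.act (op g⁻¹) : M.T →* M.T))
  map_one' := by
    ext x
    induction x using Additive.rec with | ofMul x => ?_
    obtain ⟨t, rfl⟩ := QuotientGroup.mk_surjective x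
    change Additive.ofMul (Abelianization.of (M.act (op 1⁻¹) t)) = _
    simp
    rfl
  map_mul' g h := by
    ext x
    induction x using Additive.rec with | ofMul x => ?_
    obtain ⟨t, rfl⟩ := QuotientGroup.mk_surjective x
    change Additive.ofMul (Abelianization.of (M.act (op (g * h)⁻¹) t)) =
      Additive.ofMul (Abelianization.of (M.act (op g⁻¹) (M.act (op h⁻¹) t)))
    rw [M.act_act, mul_inv_rev]

theorem abelianizationAction_apply (g : G) (t : M.T) :
    M.abelianizationAction g (Additive.ofMul (Abelianization.of t)) =
      Additive.ofMul (Abelianization.of (M.act (op g⁻¹) t)) := rfl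

/-- By the Peiffer identity boundaries act on `T` by inner automorphisms. So the action on the
abelianization factors through the cokernel of `∂`. -/
theorem abelianizationAction_bdry (s : M.T) : M.abelianizationAction (M.bdry s) = 1 := by
  ext x
  induction x using Additive.rec with | ofMul x => ?_
  obtain ⟨t, rfl⟩ := QuotientGroup.mk_surjective x
  change Additive.ofMul (Abelianization.of (M.act (op (M.bdry s)⁻¹) t)) =
    Additive.ofMul (Abelianization.of t)
  congr 1
  rw [← map_inv, M.peiffer, map_mul, map_mul, mul_right_comm, ← map_mul, inv_mul_cancel, map_one,
    one_mul]

variable {M}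

theorem isNoetherian_abelianization [Group.FG G] (hM : M.ActFG) {k : ℕ}
    (hk : iterComm (⊤ : Subgroup G) k ≤ M.bdry.range) :
    IsNoetherian (groupSubring M.abelianizationAction ⊤) (Additive (Abelianization M.T)) := by
  have := isNoetherianRing_groupSubring_top M.abelianizationAction k fun g hg => by
    obtain ⟨s, rfl⟩ := hk hg
    exact M.abelianizationAction_bdry s
  obtain ⟨Y, hYf, hY⟩ := hM
  have : Module.Finite (groupSubring M.abelianizationAction ⊤)
      (Additive (Abelianization M.T)) := by
    refine ⟨Submodule.fg_def.2 ⟨(fun t => Additive.ofMul (Abelianization.of t)) '' Y,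
      hYf.image _, ?_⟩⟩
    set N := Submodule.span (groupSubring M.abelianizationAction ⊤)
      ((fun t => Additive.ofMul (Abelianization.of t)) '' Y) with hN
    let W : Subgroup M.T :=
      { carrier := {t | Additive.ofMul (Abelianization.of t) ∈ N}
        one_mem' := zero_mem N
        mul_mem' := fun ha hb => N.add_mem ha hb
        inv_mem' := fun ha => N.neg_mem ha }
    have hW : W = ⊤ := by
      refine hY W (fun g w hw => ?_) fun y hy => Submodule.subset_span ⟨y, hy, rfl⟩
      have := N.smul_mem ⟨M.abelianizationAction g⁻¹, mem_groupSubring (Subgroup.mem_top _)⟩ hw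
      change M.abelianizationAction g⁻¹ _ ∈ N at this
      rwa [abelianizationAction_apply, inv_inv] at this
    rw [eq_top_iff]
    intro x _
    induction x using Additive.rec with | ofMul x => ?_
    obtain ⟨t, rfl⟩ := QuotientGroup.mk_surjective x
    exact (hW ▸ Subgroup.mem_top t : t ∈ W)
  exact isNoetherian_of_isNoetherianRing_of_finite _ _

/-- A subgroup of the kernel of `∂` on which `G` acts trivially is finitely generated, if `G` is
free, `T` is finitely generated as a `G`-group and the cokernel of `∂` is nilpotent. -/
theorem fg_of_act_trivial [Group.FG G] [IsFreeGroup G] (hM : M.ActFG) {k : ℕ}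
    (hk : iterComm (⊤ : Subgroup G) k ≤ M.bdry.range) {K : Subgroup M.T} (hK : K ≤ M.bdry.ker)
    (htriv : ∀ g, ∀ t ∈ K, M.act (op g) t = t) : K.FG := by
  have := isNoetherian_abelianization hM hk
  let A := Additive (Abelianization M.T)
  let R := groupSubring M.abelianizationAction ⊤
  let L : AddSubgroup A := Subgroup.toAddSubgroup (K.map Abelianization.of)
  -- The generators of `R` fix `L` pointwise, so additive subgroups of `L` are submodules, and
  -- module generators of `L` already generate it as a group.
  have hL : ∀ Z : AddSubgroup A, Z ≤ L → ∀ r ∈ R, ∀ x ∈ Z, r x ∈ Z := by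
    intro Z hZ r hr x hx
    induction hr using Subring.closure_induction generalizing x with
    | mem r hr =>
      obtain ⟨g, -, rfl⟩ := hr
      obtain ⟨t, ht, e⟩ := hZ hx
      have e' : x = Additive.ofMul (Abelianization.of t) := e.symm
      rwa [e', abelianizationAction_apply, htriv _ t ht, ← e']
    | zero => exact zero_mem Z
    | one => exact hx
    | add a b _ _ ha hb => exact add_mem (ha x hx) (hb x hx)
    | neg a _ ha => exact neg_mem (ha x hx)
    | mul a b _ _ ha hb => exact ha _ (hb x hx)
  let toSub : ∀ Z : AddSubgroup A, Z ≤ L → Submodule R A := fun Z hZ =>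
    { Z with smul_mem' := fun r x hx => hL Z hZ r r.2 x hx }
  obtain ⟨S, hSf, hS⟩ := Submodule.fg_def.1 (IsNoetherian.noetherian (toSub L le_rfl))
  have hSL : AddSubgroup.closure S ≤ L := (AddSubgroup.closure_le L).2 fun x hx =>
    (show x ∈ toSub L le_rfl from hS ▸ Submodule.subset_span hx)
  have hLS : L ≤ AddSubgroup.closure S := fun x hx => by
    have h1 : x ∈ Submodule.span R S := by rw [hS]; exact hx
    exact (Submodule.span_le.2 AddSubgroup.subset_closure :
      Submodule.span R S ≤ toSub (AddSubgroup.closure S) hSL) h1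
  have hfg : (K.map Abelianization.of).FG :=
    (Subgroup.fg_iff_add_fg _).2 ((AddSubgroup.fg_iff _).2 ⟨S, le_antisymm hSL hLS, hSf⟩)
  refine fg_of_fg_map_of_fg_inf_ker _ hfg ?_
  have : K ⊓ Abelianization.of.ker = ⊥ := by
    rw [eq_bot_iff]
    rintro t ⟨h1, h2⟩
    exact M.eq_one_of_abelianization_eq_one (hK h1) h2
  rw [this]
  exact Subgroup.FG.bot

end CrossedModule

/-! ### Tensor powers of a free group. -/

variable {G : Type u} [Group G]

theorem actFG_powerModule [Group.FG G] : ∀ n, (powerModule G n).ActFG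
  | 0 => CrossedModule.actFG_refl
  | 1 => CrossedModule.actFG_refl
  | n + 2 => CrossedModule.actFG_tensor (actFG_powerModule (n + 1))

theorem CrossedModule.commutator_le_range_tensor (M : CrossedModule G) :
    ⁅M.bdry.range, (⊤ : Subgroup G)⁆ ≤ M.tensor.bdry.range := by
  rw [Subgroup.commutator_le]
  rintro _ ⟨t, rfl⟩ g -
  -- The inverses reconcile `[x, y] = x⁻¹ y⁻¹ x y` in the boundary with `⁅x, y⁆ = x y x⁻¹ y⁻¹`.
  refine ⟨tmul M.act M.coact t⁻¹ g⁻¹, ?_⟩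
  change M.tensorBdry _ = _
  rw [tensorBdry_tmul, map_inv, inv_inv, inv_inv, commutatorElement_def]

theorem iterComm_le_range_bdry (n : ℕ) :
    iterComm (⊤ : Subgroup G) n ≤ (powerModule G (n + 1)).bdry.range := by
  induction n with
  | zero => exact fun g _ => ⟨g, rfl⟩
  | succ n ih =>
    exact (Subgroup.commutator_mono ih le_rfl).trans
      (CrossedModule.commutator_le_range_tensor (powerModule G (n + 1)))

theorem fg_ker_bdry_of_isFreeGroup [Group.FG G] [IsFreeGroup G] (n : ℕ) :
    (powerModule G (n + 1)).bdry.ker.FG := by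
  induction n with
  | zero =>
    have : (powerModule G 1).bdry.ker = ⊥ := by
      rw [MonoidHom.ker_eq_bot_iff]
      exact Function.injective_id
    rw [this]
    exact Subgroup.FG.bot
  | succ n ih =>
    let M := powerModule G (n + 1)
    change (M.tensorBdry.ker).FG
    refine fg_of_fg_map_of_fg_inf_ker M.displacement ?_ ?_
    · refine fg_of_le_of_commute ih (fun a ha b _ => M.commute_of_bdry_eq_one ha b) ?_
      rintro _ ⟨x, hx, rfl⟩
      exact (M.bdry_displacement x).trans hx
    -- If the displacement of `x` is trivial then `x^g = x (1 ⊗ g) = x`.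
    · refine CrossedModule.fg_of_act_trivial (M := M.tensor) (actFG_powerModule (n + 2))
        (iterComm_le_range_bdry (n + 1)) inf_le_left fun g x hx => ?_
      have e := M.diag_eq_mul_tmul x g
      rw [show M.displacement x = 1 from hx.2, M.one_tmul] at e
      exact e.trans (mul_one _)

/-! ### Functoriality of tensor powers and reduction to free groups. -/

section Functoriality

variable {F : Type u} {G : Type v} [Group F] [Group G]

/-- A morphism of crossed modules over a homomorphism `φ` of the base groups. -/
structure CrossedModule.Hom (φ : F →* G) (M : CrossedModule F) (N : CrossedModule G) where
  toHom : M.T →* N.T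
  bdry_toHom : ∀ t, N.bdry (toHom t) = φ (M.bdry t)
  toHom_act : ∀ g t, toHom (M.act (op g) t) = N.act (op (φ g)) (toHom t)

namespace CrossedModule.Hom

variable {φ : F →* G} {M : CrossedModule F} {N : CrossedModule G}

/-- The morphism `φ` between the identity crossed modules. -/
def refl (φ : F →* G) : Hom φ (CrossedModule.refl F) (CrossedModule.refl G) where
  toHom := φ
  bdry_toHom _ := rfl
  toHom_act g (t : F) := by
    change φ (conjAction F (op g) t) = conjAction G (op (φ g)) (φ t)
    simp

/-- The homomorphism `t ⊗ g ↦ α t ⊗ φ g`. -/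
def tensorMap (α : Hom φ M N) : M.tensorType →* N.tensorType :=
  Tensor.lift (fun t g => tmul N.act N.coact (α.toHom t) (φ g))
    (fun t s g => by
      rw [map_mul, tmul_mul_left]
      simp [α.bdry_toHom])
    (fun t g h => by
      rw [map_mul, tmul_mul_right]
      simp [α.toHom_act])

@[simp] theorem tensorMap_tmul (α : Hom φ M N) (t : M.T) (g : F) :
    α.tensorMap (tmul M.act M.coact t g) = tmul N.act N.coact (α.toHom t) (φ g) :=
  Tensor.lift_tmul ..

/-- The morphism induced on the crossed modules `T ⊗ G → G`. -/
def tensor (α : Hom φ M N) : Hom φ M.tensor N.tensor where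
  toHom := α.tensorMap
  bdry_toHom t := by
    have : N.tensorBdry.comp α.tensorMap = φ.comp M.tensorBdry :=
      Tensor.hom_ext fun t g => by simp [α.bdry_toHom]
    exact DFunLike.congr_fun this t
  toHom_act g t := by
    have : α.tensorMap.comp (M.diag g) = (N.diag (φ g)).comp α.tensorMap :=
      Tensor.hom_ext fun t x => by simp [α.toHom_act]
    exact DFunLike.congr_fun this t

theorem tensorMap_surjective (α : Hom φ M N) (hφ : Function.Surjective φ)
    (hα : Function.Surjective α.toHom) : Function.Surjective α.tensorMap := by
  rw [← MonoidHom.range_eq_top, eq_top_iff]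
  intro x _
  refine PresentedGroup.generated_by _ α.tensorMap.range (fun p => ?_) x
  obtain ⟨t, ht⟩ := hα p.1
  obtain ⟨g, hg⟩ := hφ p.2
  exact ⟨tmul M.act M.coact t g, by rw [tensorMap_tmul, ht, hg]; rfl⟩

/-- If `t` dies in `N`, so does every `t ⊗ g`, whose boundary is a commutator of `∂ t`. Iterated,
this gives `iterComm_ker_le`. -/
theorem commutator_map_ker_le (α : Hom φ M N) :
    ⁅α.toHom.ker.map M.bdry, (⊤ : Subgroup F)⁆ ≤ α.tensorMap.ker.map M.tensorBdry := by
  rw [Subgroup.commutator_le]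
  rintro _ ⟨t, ht, rfl⟩ g -
  refine ⟨tmul M.act M.coact t⁻¹ g⁻¹, ?_, ?_⟩
  · change α.tensorMap _ = 1
    rw [tensorMap_tmul, map_inv, show α.toHom t = 1 from ht, inv_one, one_tmul]
  · rw [tensorBdry_tmul, map_inv, inv_inv, inv_inv, commutatorElement_def]

end CrossedModule.Hom

variable (φ : F →* G)

/-- The homomorphism `F^{⊗n} → G^{⊗n}` induced by `φ`. -/
def powerHom : ∀ n, CrossedModule.Hom φ (powerModule F n) (powerModule G n)
  | 0 => CrossedModule.Hom.refl φ
  | 1 => CrossedModule.Hom.refl φ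
  | n + 2 => (powerHom (n + 1)).tensor

theorem powerHom_surjective (hφ : Function.Surjective φ) (n : ℕ) :
    Function.Surjective (powerHom φ (n + 1)).toHom := by
  induction n with
  | zero => exact hφ
  | succ n ih => exact (powerHom φ (n + 1)).tensorMap_surjective hφ ih

theorem iterComm_ker_le (n : ℕ) :
    iterComm φ.ker n ≤ (powerHom φ (n + 1)).toHom.ker.map (powerModule F (n + 1)).bdry := by
  induction n with
  | zero => exact fun g hg => ⟨g, hg, rfl⟩
  | succ n ih =>
    exact (Subgroup.commutator_mono ih le_rfl).trans
      (powerHom φ (n + 1)).commutator_map_ker_le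

end Functoriality

theorem fg_ker_bdry {G : Type u} [Group G] [Group.IsFinitelyPresented G] (n : ℕ) :
    (powerModule G (n + 1)).bdry.ker.FG := by
  obtain ⟨d, φ, hφ, X, hXf, hX⟩ := ‹Group.IsFinitelyPresented G›.out
  let F := FreeGroup (Fin d)
  obtain ⟨Y, hY, hYf⟩ := Group.fg_iff.1 (inferInstance : Group.FG F)
  let M := powerModule F (n + 1)
  let N := powerModule G (n + 1)
  let π := powerHom φ (n + 1)
  have hXR : X ⊆ φ.ker := hX ▸ Subgroup.subset_normalClosure
  -- Anything between `[R, F]` and `R` is normal in `F`, so the right side contains the normal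
  -- closure of the relators.
  have hR : φ.ker ≤ Subgroup.closure X ⊔ ⁅φ.ker, (⊤ : Subgroup F)⁆ := by
    have hle : Subgroup.closure X ⊔ ⁅φ.ker, (⊤ : Subgroup F)⁆ ≤ φ.ker :=
      sup_le ((Subgroup.closure_le _).2 hXR) (Subgroup.commutator_le_left _ _)
    have : (Subgroup.closure X ⊔ ⁅φ.ker, (⊤ : Subgroup F)⁆).Normal :=
      Subgroup.commutator_top_right_le_iff.1
        ((Subgroup.commutator_mono hle le_rfl).trans le_sup_right)
    have h := Subgroup.normalClosure_le_normal
      (Subgroup.subset_closure.trans (SetLike.coe_subset_coe.2 le_sup_left) :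
        X ⊆ (Subgroup.closure X ⊔ ⁅φ.ker, (⊤ : Subgroup F)⁆ : Subgroup F))
    rwa [hX] at h
  obtain ⟨Z, hZf, hZH, hZ⟩ := exists_finite_le_closure_sup_iterComm hXR hXf hYf hY hR
    (inf_le_left (b := M.bdry.range)) n
  obtain ⟨S, hS, hSf⟩ := (Subgroup.fg_iff _).1 (fg_ker_bdry_of_isFreeGroup (G := F) n)
  have hlift : ∀ z ∈ Z, ∃ t, M.bdry t = z := fun z hz => (hZH hz).2
  choose! r hr using hlift
  have hrZ : M.bdry '' (r '' Z) = Z := by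
    rw [Set.image_image]
    exact (Set.image_congr hr).trans (Set.image_id _)
  have hle : Subgroup.closure (r '' Z ∪ S) ≤ (N.bdry.comp π.toHom).ker := by
    refine (Subgroup.closure_le _).2 (Set.union_subset ?_ fun s hs => ?_)
    · rintro _ ⟨z, hz, rfl⟩
      change N.bdry (π.toHom (r z)) = 1
      rw [π.bdry_toHom, hr z hz]
      exact (hZH hz).1
    · change N.bdry (π.toHom s) = 1
      have : s ∈ M.bdry.ker := hS ▸ Subgroup.subset_closure hs
      rw [π.bdry_toHom, show M.bdry s = 1 from this, map_one]
  refine (Subgroup.fg_iff _).2 ⟨π.toHom '' (r '' Z ∪ S), le_antisymm ?_ fun x hx => ?_,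
    ((hZf.image _).union hSf).image _⟩
  · rw [← MonoidHom.map_closure]
    exact Subgroup.map_le_iff_le_comap.2 hle
  · obtain ⟨e, rfl⟩ := powerHom_surjective φ hφ n x
    have he : M.bdry e ∈ φ.ker := (π.bdry_toHom e).symm.trans hx
    -- Here `∂ e = ∂ (a k)` with `a` a product of chosen lifts and their inverses and `k` in the
    -- kernel of `π`. The remainder `(a k)⁻¹ e` lies in the kernel for `F`, and `k` disappears under
    -- `π`.
    obtain ⟨w, hw, l, hl, hwl⟩ := Subgroup.mem_sup_of_normal_right.1 (hZ ⟨he, e, rfl⟩)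
    rw [← hrZ, ← MonoidHom.map_closure] at hw
    obtain ⟨a, ha, rfl⟩ := hw
    obtain ⟨k, hk, rfl⟩ := iterComm_ker_le φ n hl
    have hj : (a * k)⁻¹ * e ∈ Subgroup.closure S := by
      rw [hS, MonoidHom.mem_ker, map_mul, map_inv, map_mul]
      exact inv_mul_eq_one.2 hwl
    have hak : π.toHom e = π.toHom (a * ((a * k)⁻¹ * e)) := by
      have hk' : π.toHom k = 1 := hk
      simp [hk']
    change π.toHom e ∈ _
    rw [← MonoidHom.map_closure, hak]
    exact Subgroup.mem_map_of_mem _ (mul_mem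
      (Subgroup.closure_mono Set.subset_union_left ha)
      (Subgroup.closure_mono Set.subset_union_right hj))

end NonabelianTensor

theorem mainTheorem4 {G : Type*} [Group G] [Group.IsFinitelyPresented G] (n : ℕ) (hn : 2 ≤ n) :
    (NonabelianTensor.lambda G n).ker.FG ∧
      IsMulCommutative (NonabelianTensor.lambda G n).ker := by
  have hker : (NonabelianTensor.lambda G n).ker = (NonabelianTensor.powerModule G n).bdry.ker :=
    MonoidHom.ker_codRestrict _ _ _
  obtain ⟨m, rfl⟩ : ∃ m, n = m + 1 := ⟨n - 1, by omega⟩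
  rw [hker]
  exact ⟨NonabelianTensor.fg_ker_bdry m, ⟨⟨fun a b =>
    Subtype.ext ((NonabelianTensor.powerModule G (m + 1)).commute_of_bdry_eq_one a.2 b)⟩⟩⟩
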